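/- Let $\xi_1,\xi_2,\dots$ be independent fair coin tosses, $\mathbb P(\xi_i=1)=\mathbb P(\xi_i=-1)=\tfrac12$, where $1$ stands for Heads and $-1$ for Tails. Let $H_N$ and $T_N$ be the numbers of Heads and of Tails among the first $N$ tosses, and for $n\ge 1$ let $$X_n=\min\{N: H_N=n\text{ or }T_N=n\},\qquad Y_n=\min\{N: H_N\ge n\text{ and }T_N\ge n\}$$ be the numbers of tosses until reaching $n$ Heads or $n$ Tails, respectively $n$ Heads and $n$ Tails. Let $Z\sim N(0,1)$. Then, as $n\to\infty$, all ordinary and absolute moments converge in the following four limit laws: $$\frac{X_n-2n}{\sqrt n}\to-\sqrt2\,|Z|,\qquad \frac{X_n-\mathbb E[X_n]}{\sqrt n}\to-\sqrt2\,\bigl(|Z|-\mathbb E|Z|\bigr),$$ $$\frac{Y_n-2n}{\sqrt n}\to\sqrt2\,|Z|,\qquad \frac{Y_n-\mathbb E[Y_n]}{\sqrt n}\to\sqrt2\,\bigl(|Z|-\mathbb E|Z|\bigr).$$ That is, if $W_n$ denotes the left-hand side and $V$ the right-hand side of any one of these four, then for every integer $k\ge0$ the moments $\mathbb E[W_n^k]$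 ($n\ge1$) and $\mathbb E[V^k]$ exist and are finite, and $\mathbb E[W_n^k]\to\mathbb E[V^k]$; and for every real $r>0$ the absolute moments $\mathbb E[|W_n|^r]$ ($n\ge1$) and $\mathbb E[|V|^r]$ are finite, and $\mathbb E[|W_n|^r]\to\mathbb E[|V|^r]$. -/

import Mathlib

open MeasureTheory ProbabilityTheory Filter Topology

namespace CoinToss

/-- `ξ 1, ξ 2, …` are independent fair coin tosses under `P` (with a spare `ξ 0`):
the value `1` is Heads, the value `-1` is Tails, and each has probability `1/2`. -/
structure IsFairCoin {Ω : Type*} [MeasurableSpace Ω] (ξ : ℕ → Ω → ℤ) (P : Measure Ω) : Prop where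
  measurable : ∀ i, Measurable (ξ i)
  indep : iIndepFun ξ P
  heads : ∀ i, P {ω | ξ i ω = 1} = 1 / 2
  tails : ∀ i, P {ω | ξ i ω = -1} = 1 / 2

/-- `H_N`: the number of Heads in the first `N` tosses. -/
def numHeads {Ω : Type*} (ξ : ℕ → Ω → ℤ) (N : ℕ) (ω : Ω) : ℕ :=
  ((Finset.Icc 1 N).filter (fun i => ξ i ω = 1)).card

/-- `T_N`: the number of Tails in the first `N` tosses. -/
def numTails {Ω : Type*} (ξ : ℕ → Ω → ℤ) (N : ℕ) (ω : Ω) : ℕ :=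
  ((Finset.Icc 1 N).filter (fun i => ξ i ω = -1)).card

/-- `X_n`: the number of tosses until reaching `n` Heads or `n` Tails.
(The set is non-empty almost surely; on the exceptional null set the value is `0`.) -/
noncomputable def tossesOr {Ω : Type*} (ξ : ℕ → Ω → ℤ) (n : ℕ) (ω : Ω) : ℕ :=
  sInf {N : ℕ | numHeads ξ N ω = n ∨ numTails ξ N ω = n}

/-- `Y_n`: the number of tosses until reaching `n` Heads and `n` Tails.
(The set is non-empty almost surely; on the exceptional null set the value is `0`.) -/
noncomputable def tossesAnd {Ω : Type*} (ξ : ℕ → Ω → ℤ) (n : ℕ) (ω : Ω) : ℕ :=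
  sInf {N : ℕ | n ≤ numHeads ξ N ω ∧ n ≤ numTails ξ N ω}

/-- All ordinary moments (of order `k : ℕ`) and all absolute moments (of real order `r > 0`) of
`W 1, W 2, …` and of `V` are finite, and those of `W n` converge to those of `V` as `n → ∞`. -/
def MomentsConverge {Ω Ω' : Type*} [MeasurableSpace Ω] [MeasurableSpace Ω']
    (W : ℕ → Ω → ℝ) (P : Measure Ω) (V : Ω' → ℝ) (Q : Measure Ω') : Prop :=
  (∀ k : ℕ,
    (∀ n : ℕ, 1 ≤ n → Integrable (fun ω => W n ω ^ k) P) ∧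
    Integrable (fun ω => V ω ^ k) Q ∧
    Tendsto (fun n : ℕ => ∫ ω, W n ω ^ k ∂P) atTop (𝓝 (∫ ω, V ω ^ k ∂Q))) ∧
  (∀ r : ℝ, 0 < r →
    (∀ n : ℕ, 1 ≤ n → Integrable (fun ω => |W n ω| ^ r) P) ∧
    Integrable (fun ω => |V ω| ^ r) Q ∧
    Tendsto (fun n : ℕ => ∫ ω, |W n ω| ^ r ∂P) atTop (𝓝 (∫ ω, |V ω| ^ r ∂Q)))

end CoinToss

/-! ### From tail convergence to moment convergence -/

namespace CoinToss

variable {Ω Ω' : Type*} [MeasurableSpace Ω] [MeasurableSpace Ω']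

/-! Let `S_N` be the sum of the first `N` tosses. Since `H_N + T_N = N` and `H_N - T_N = S_N`, the
larger and smaller counts are `(N ± |S_N|)/2`. Almost surely, therefore, `X_n ≤ N` iff `2n - N ≤
|S_N|`, and `Y_n > N` iff `N + 1 - 2n ≤ |S_N|` (`tossesOr_le_iff`, `lt_tossesAnd_iff`). Tail events
of the nonnegative variables `(2n - X_n)/√n` and `(Y_n - 2n)/√n` thus concern the walk at one
deterministic time.

At a fixed positive level that time is asymptotic to `2n`, so the central limit theorem gives the
tails of `√2 |Z|`. Hoeffding's inequality gives exponential tail bounds uniform in `n`.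
`TailConverge` packages these two facts, and the layer-cake formula with dominated convergence
(`tendsto_moment_of_tail`) turns them into moment convergence. Convergence of the first moment then
allows centering. -/

theorem lintegral_exp_mul_rpow_lt_top {K b r : ℝ} (hK : 0 ≤ K) (hb : 0 < b) (hr : 0 < r) :
    ∫⁻ t in Set.Ioi (0 : ℝ), ENNReal.ofReal (K * Real.exp (-b * t)) * ENNReal.ofReal (t ^ (r - 1))
      < ⊤ := by
  have h := (integrableOn_rpow_mul_exp_neg_mul_rpow (p := 1) (s := r - 1) (b := b) (by linarith)
    one_pos hb).const_mul K
  have h2 := h.lintegral_lt_top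
  refine lt_of_le_of_lt (lintegral_mono fun t => ?_) h2
  rw [← ENNReal.ofReal_mul (by positivity)]
  apply le_of_eq
  congr 1
  simp only [Real.rpow_one]
  ring

/-- Exponential tail bounds and pointwise convergence of the tails give convergence of all
moments of nonnegative random variables. -/
theorem tendsto_moment_of_tail {P : Measure Ω} [IsProbabilityMeasure P] {Q : Measure Ω'}
    [IsProbabilityMeasure Q] {f : ℕ → Ω → ℝ} {g : Ω' → ℝ}
    (hf0 : ∀ n ω, 0 ≤ f n ω) (hg0 : ∀ ω, 0 ≤ g ω)
    (hf : ∀ n, AEMeasurable (f n) P) (hg : AEMeasurable g Q)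
    {K b : ℝ} (hb : 0 < b)
    (htail : ∀ n, 1 ≤ n → ∀ t, 0 < t → P.real {ω | t ≤ f n ω} ≤ K * Real.exp (-b * t))
    (hconv : ∀ᵐ t : ℝ, 0 < t →
      Tendsto (fun n => P.real {ω | t ≤ f n ω}) atTop (𝓝 (Q.real {ω | t ≤ g ω})))
    {r : ℝ} (hr : 0 < r) :
    (∀ n : ℕ, 1 ≤ n → Integrable (fun ω => f n ω ^ r) P) ∧
    Integrable (fun ω => g ω ^ r) Q ∧
    Tendsto (fun n : ℕ => ∫ ω, f n ω ^ r ∂P) atTop (𝓝 (∫ ω, g ω ^ r ∂Q)) := by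
  have hK : 0 ≤ K := by
    have := (measureReal_nonneg (μ := P)).trans (htail 1 le_rfl 1 one_pos)
    exact nonneg_of_mul_nonneg_left this (Real.exp_pos _)
  have hfin := lintegral_exp_mul_rpow_lt_top hK hb hr
  have hfr (n) : AEMeasurable (fun ω => f n ω ^ r) P := (hf n).pow_const r
  have hgr : AEMeasurable (fun ω => g ω ^ r) Q := hg.pow_const r
  have hbound (n : ℕ) (hn : 1 ≤ n) : ∀ t ∈ Set.Ioi (0 : ℝ),
      P {ω | t ≤ f n ω} * ENNReal.ofReal (t ^ (r - 1)) ≤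
        ENNReal.ofReal (K * Real.exp (-b * t)) * ENNReal.ofReal (t ^ (r - 1)) := by
    intro t ht
    gcongr
    rw [← ENNReal.ofReal_toReal (measure_ne_top P {ω | t ≤ f n ω})]
    exact ENNReal.ofReal_le_ofReal (htail n hn t ht)
  have hlim : ∀ᵐ t ∂(volume.restrict (Set.Ioi (0 : ℝ))),
      Tendsto (fun n => P {ω | t ≤ f n ω} * ENNReal.ofReal (t ^ (r - 1))) atTop
        (𝓝 (Q {ω | t ≤ g ω} * ENNReal.ofReal (t ^ (r - 1)))) := by
    filter_upwards [ae_restrict_of_ae hconv, self_mem_ae_restrict measurableSet_Ioi] with t h ht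
    refine ENNReal.Tendsto.mul_const ?_ (Or.inr ENNReal.ofReal_ne_top)
    exact (ENNReal.tendsto_toReal_iff (fun n => measure_ne_top _ _) (measure_ne_top _ _)).1 (h ht)
  have hmeas {Ω'' : Type _} [MeasurableSpace Ω''] (R : Measure Ω'') (u : Ω'' → ℝ) :
      Measurable fun t : ℝ => R {ω | t ≤ u ω} * ENNReal.ofReal (t ^ (r - 1)) := by
    have : Antitone fun t : ℝ => R {ω | t ≤ u ω} :=
      fun s t hst => measure_mono fun ω (h : t ≤ u ω) => hst.trans h
    exact this.measurable.mul (by fun_prop)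
  have hconvL := tendsto_lintegral_filter_of_dominated_convergence
    (μ := volume.restrict (Set.Ioi (0 : ℝ))) (l := atTop) _
    (Eventually.of_forall fun n => hmeas P (f n))
    (by filter_upwards [eventually_ge_atTop 1] with n hn
        filter_upwards [self_mem_ae_restrict measurableSet_Ioi] with t ht
        exact hbound n hn t ht) hfin.ne hlim
  have hlf (n) := lintegral_rpow_eq_lintegral_meas_le_mul P (Eventually.of_forall (hf0 n)) (hf n) hr
  have hlg := lintegral_rpow_eq_lintegral_meas_le_mul Q (Eventually.of_forall hg0) hg hr
  have hffin (n : ℕ) (hn : 1 ≤ n) : ∫⁻ ω, ENNReal.ofReal (f n ω ^ r) ∂P ≠ ⊤ := by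
    rw [hlf]
    refine ENNReal.mul_ne_top ENNReal.ofReal_ne_top (lt_of_le_of_lt ?_ hfin).ne
    exact setLIntegral_mono' measurableSet_Ioi (hbound n hn)
  have hgfin : ∫⁻ ω, ENNReal.ofReal (g ω ^ r) ∂Q ≠ ⊤ := by
    rw [hlg]
    refine ENNReal.mul_ne_top ENNReal.ofReal_ne_top (lt_of_le_of_lt ?_ hfin).ne
    -- The limiting tail inherits the exponential envelope almost everywhere, so no moment
    -- assumption on `g` is needed.
    refine lintegral_mono_ae ?_
    filter_upwards [hlim, self_mem_ae_restrict measurableSet_Ioi] with t h ht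
    refine le_of_tendsto h ?_
    filter_upwards [eventually_ge_atTop 1] with n hn using hbound n hn t ht
  refine ⟨fun n hn => ?_, ?_, ?_⟩
  · exact (lintegral_ofReal_ne_top_iff_integrable (hfr n).aestronglyMeasurable
      (Eventually.of_forall fun ω => Real.rpow_nonneg (hf0 n ω) r)).1 (hffin n hn)
  · exact (lintegral_ofReal_ne_top_iff_integrable hgr.aestronglyMeasurable
      (Eventually.of_forall fun ω => Real.rpow_nonneg (hg0 ω) r)).1 hgfin
  · have h1 (n) : ∫ ω, f n ω ^ r ∂P = (∫⁻ ω, ENNReal.ofReal (f n ω ^ r) ∂P).toReal :=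
      integral_eq_lintegral_of_nonneg_ae
        (Eventually.of_forall fun ω => Real.rpow_nonneg (hf0 n ω) r) (hfr n).aestronglyMeasurable
    have h2 : ∫ ω, g ω ^ r ∂Q = (∫⁻ ω, ENNReal.ofReal (g ω ^ r) ∂Q).toReal :=
      integral_eq_lintegral_of_nonneg_ae
        (Eventually.of_forall fun ω => Real.rpow_nonneg (hg0 ω) r) hgr.aestronglyMeasurable
    simp_rw [h1, h2]
    refine (ENNReal.tendsto_toReal hgfin).comp ?_
    simp_rw [hlf, hlg]
    exact ENNReal.Tendsto.const_mul hconvL (Or.inr ENNReal.ofReal_ne_top)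

/-- Nonnegative random variables `U n` with uniformly exponential tails, whose tails converge
continuously to those of a nonnegative `V` without atoms. -/
structure TailConverge (U : ℕ → Ω → ℝ) (P : Measure Ω) (V : Ω' → ℝ) (Q : Measure Ω') : Prop where
  aemeasurable : ∀ n, AEMeasurable (U n) P
  aemeasurable_limit : AEMeasurable V Q
  nonneg : ∀ n, ∀ᵐ ω ∂P, 0 ≤ U n ω
  nonneg_limit : ∀ ω, 0 ≤ V ω
  noAtom : ∀ y, Q {ω | V ω = y} = 0
  tail : ∃ K b : ℝ, 0 < b ∧
    ∀ n, 1 ≤ n → ∀ t, 0 < t → P.real {ω | t ≤ U n ω} ≤ K * Real.exp (-b * t)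
  -- Levels move with `n` because centering subtracts an `n`-dependent constant. Negative limits are
  -- automatic, and the single level `0` is negligible under the layer-cake integral.
  tendsto : ∀ (y : ℕ → ℝ) (y₀ : ℝ), 0 < y₀ → Tendsto y atTop (𝓝 y₀) →
    Tendsto (fun n => P.real {ω | y n ≤ U n ω}) atTop (𝓝 (Q.real {ω | y₀ ≤ V ω}))

namespace TailConverge

variable {U : ℕ → Ω → ℝ} {P : Measure Ω} [IsProbabilityMeasure P] {V : Ω' → ℝ} {Q : Measure Ω'}
  [IsProbabilityMeasure Q]

theorem tendsto_of_ne (h : TailConverge U P V Q) {y : ℕ → ℝ} {y₀ : ℝ} (hy₀ : y₀ ≠ 0)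
    (hy : Tendsto y atTop (𝓝 y₀)) :
    Tendsto (fun n => P.real {ω | y n ≤ U n ω}) atTop (𝓝 (Q.real {ω | y₀ ≤ V ω})) := by
  rcases hy₀.lt_or_gt with hneg | hpos
  · have h1 : Q.real {ω | y₀ ≤ V ω} = 1 := by
      have : {ω | y₀ ≤ V ω} = Set.univ :=
        Set.eq_univ_of_forall fun ω => hneg.le.trans (h.nonneg_limit ω)
      simp [this]
    rw [h1]
    refine tendsto_const_nhds.congr' ?_
    filter_upwards [hy.eventually (gt_mem_nhds hneg)] with n hn
    symm
    have : ∀ᵐ ω ∂P, ω ∈ {ω | y n ≤ U n ω} := by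
      filter_upwards [h.nonneg n] with ω hω using hn.le.trans hω
    refine (measureReal_congr (t := Set.univ) ?_).trans (by simp)
    exact eventuallyEq_univ.2 this
  · exact h.tendsto y y₀ hpos hy

theorem tendsto_lt_of_ne (h : TailConverge U P V Q) {y : ℕ → ℝ} {y₀ : ℝ} (hy₀ : y₀ ≠ 0)
    (hy : Tendsto y atTop (𝓝 y₀)) :
    Tendsto (fun n => P.real {ω | y n < U n ω}) atTop (𝓝 (Q.real {ω | y₀ ≤ V ω})) := by
  have hy' : Tendsto (fun n : ℕ => y n + 1 / ((n : ℝ) + 1)) atTop (𝓝 y₀) := by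
    simpa using hy.add tendsto_one_div_add_atTop_nhds_zero_nat
  refine tendsto_of_tendsto_of_tendsto_of_le_of_le (h.tendsto_of_ne hy₀ hy')
    (h.tendsto_of_ne hy₀ hy) (fun n => ?_) (fun n => ?_)
  · refine measureReal_mono fun ω (hω : _ ≤ U n ω) => ?_
    have : 0 < 1 / ((n : ℝ) + 1) := by positivity
    change _ < U n ω
    linarith
  · exact measureReal_mono fun ω (hω : _ < U n ω) => hω.le

theorem measureReal_le_abs_sub {Ω : Type*} [MeasurableSpace Ω] (P : Measure Ω)
    [IsProbabilityMeasure P] {u : Ω → ℝ} (hu : AEMeasurable u P) (c : ℝ) {x : ℝ} (hx : 0 < x) :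
    P.real {ω | x ≤ |u ω - c|} = P.real {ω | c + x ≤ u ω} + (1 - P.real {ω | c - x < u ω}) := by
  have h2 : NullMeasurableSet {ω | c - x < u ω} P := nullMeasurableSet_lt aemeasurable_const hu
  rw [← probReal_compl_eq_one_sub₀ h2, ← measureReal_union₀ h2.compl]
  · congr 1
    ext ω
    simp only [Set.mem_ofPred_eq, Set.mem_union, Set.mem_compl_iff, not_lt, le_abs]
    constructor <;> rintro (h | h)
    · left; linarith
    · right; linarith
    · left; linarith
    · right; linarith
  · refine (Set.disjoint_left.2 fun ω (h : _ ≤ u ω) => ?_).aedisjoint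
    simp only [Set.mem_compl_iff, Set.mem_ofPred_eq, not_lt, not_le]
    linarith

/-- Both sides of the deviation are tails of `U n` at moving levels. As `U n` and `c n` are
nonnegative, a downward deviation cannot exceed `sup c`. Beyond that the tail of `U n` dominates;
below it the trivial bound `1` is absorbed into the constant `exp (b * C)`. -/
theorem abs_sub_moments (h : TailConverge U P V Q) {c : ℕ → ℝ} {c₀ : ℝ} (hc0 : ∀ n, 0 ≤ c n)
    (hc : Tendsto c atTop (𝓝 c₀)) {r : ℝ} (hr : 0 < r) :
    (∀ n : ℕ, 1 ≤ n → Integrable (fun ω => |U n ω - c n| ^ r) P) ∧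
    Integrable (fun ω => |V ω - c₀| ^ r) Q ∧
    Tendsto (fun n : ℕ => ∫ ω, |U n ω - c n| ^ r ∂P) atTop (𝓝 (∫ ω, |V ω - c₀| ^ r ∂Q)) := by
  obtain ⟨K, b, hb, htail⟩ := h.tail
  obtain ⟨C, hC⟩ := hc.bddAbove_range
  have hC (n) : c n ≤ C := hC (Set.mem_range_self n)
  have hc₀ : 0 ≤ c₀ := ge_of_tendsto' hc hc0
  refine tendsto_moment_of_tail (K := max K (Real.exp (b * C))) (b := b)
    (fun n ω => abs_nonneg _) (fun ω => abs_nonneg _)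
    (fun n => ((h.aemeasurable n).sub_const _).abs) ((h.aemeasurable_limit).sub_const _).abs
    hb ?_ ?_ hr
  · intro n hn t ht
    rcases le_or_gt t C with htC | htC
    · refine measureReal_le_one.trans ?_
      calc (1 : ℝ) ≤ Real.exp (b * C) * Real.exp (-b * t) := by
            rw [← Real.exp_add]
            apply Real.one_le_exp
            nlinarith
        _ ≤ _ := by gcongr; exact le_max_right _ _
    · calc P.real {ω | t ≤ |U n ω - c n|} ≤ P.real {ω | t ≤ U n ω} := by
            refine ENNReal.toReal_mono (measure_ne_top _ _) (measure_mono_ae ?_)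
            filter_upwards [h.nonneg n] with ω hω hle
            rcases le_abs.1 hle with h1 | h1
            · exact (by linarith [hc0 n] : t ≤ U n ω)
            · exact absurd (hC n) (by linarith)
        _ ≤ K * Real.exp (-b * t) := htail n hn t ht
        _ ≤ _ := by gcongr; exact le_max_left _ _
  -- At `t = c₀` the lower level `c₀ - t` would be `0`, the one level not covered.
  · have : ∀ᵐ t : ℝ, t ≠ c₀ := by simp [ae_iff]
    filter_upwards [this] with t htc ht
    have hQ : Q.real {ω | c₀ - t < V ω} = Q.real {ω | c₀ - t ≤ V ω} := by
      refine measureReal_congr ?_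
      have h0 : ∀ᵐ ω ∂Q, V ω ≠ c₀ - t := by simpa [ae_iff] using h.noAtom (c₀ - t)
      filter_upwards [h0] with ω hω
      exact propext ⟨fun (h1 : _ < _) => h1.le, fun (h1 : _ ≤ _) => lt_of_le_of_ne h1 hω.symm⟩
    simp_rw [measureReal_le_abs_sub P (h.aemeasurable _) _ ht,
      measureReal_le_abs_sub Q h.aemeasurable_limit _ ht, hQ]
    refine (h.tendsto_of_ne (by positivity) (hc.add_const t)).add
      (tendsto_const_nhds.sub (h.tendsto_lt_of_ne ?_ (hc.sub_const t)))
    intro h0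
    exact htc (by linarith)

theorem pow_moments (h : TailConverge U P V Q) (k : ℕ) :
    (∀ n : ℕ, 1 ≤ n → Integrable (fun ω => U n ω ^ k) P) ∧
    Integrable (fun ω => V ω ^ k) Q ∧
    Tendsto (fun n : ℕ => ∫ ω, U n ω ^ k ∂P) atTop (𝓝 (∫ ω, V ω ^ k ∂Q)) := by
  rcases Nat.eq_zero_or_pos k with rfl | hk
  · simp
  obtain ⟨h1, h2, h3⟩ := h.abs_sub_moments (c := fun _ => 0) (fun _ => le_rfl) tendsto_const_nhds
    (r := k) (by exact_mod_cast hk)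
  simp only [sub_zero, Real.rpow_natCast] at h1 h2 h3
  have e1 (n) : (fun ω => |U n ω| ^ k) =ᵐ[P] fun ω => U n ω ^ k := by
    filter_upwards [h.nonneg n] with ω hω
    rw [abs_of_nonneg hω]
  have e2 : (fun ω => |V ω| ^ k) = fun ω => V ω ^ k := by
    ext ω
    rw [abs_of_nonneg (h.nonneg_limit ω)]
  rw [e2] at h2 h3
  refine ⟨fun n hn => (h1 n hn).congr (e1 n), h2, ?_⟩
  simpa only [integral_congr_ae (e1 _)] using h3

/-- Signed powers are not determined by absolute moments, so they are expanded binomially in the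
moments of `U n`. -/
theorem momentsConverge_sub (h : TailConverge U P V Q) {c : ℕ → ℝ} {c₀ : ℝ} (hc0 : ∀ n, 0 ≤ c n)
    (hc : Tendsto c atTop (𝓝 c₀)) :
    MomentsConverge (fun n ω => U n ω - c n) P (fun ω => V ω - c₀) Q := by
  refine ⟨fun k => ?_, fun r hr => h.abs_sub_moments hc0 hc hr⟩
  have hint (n : ℕ) (hn : 1 ≤ n) : ∀ m ∈ Finset.range (k + 1),
      Integrable (fun ω => U n ω ^ m * (-c n) ^ (k - m) * (k.choose m : ℝ)) P := fun m _ =>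
    (((h.pow_moments m).1 n hn).mul_const _).mul_const _
  have hint' : ∀ m ∈ Finset.range (k + 1),
      Integrable (fun ω => V ω ^ m * (-c₀) ^ (k - m) * (k.choose m : ℝ)) Q := fun m _ =>
    ((h.pow_moments m).2.1.mul_const _).mul_const _
  simp_rw [sub_eq_add_neg, add_pow]
  refine ⟨fun n hn => integrable_finsetSum _ (hint n hn), integrable_finsetSum _ hint', ?_⟩
  rw [integral_finsetSum _ hint']
  have : (fun n : ℕ => ∑ m ∈ Finset.range (k + 1),
      ∫ ω, U n ω ^ m * (-c n) ^ (k - m) * (k.choose m : ℝ) ∂P) =ᶠ[atTop] fun n =>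
      ∫ ω, ∑ m ∈ Finset.range (k + 1), U n ω ^ m * (-c n) ^ (k - m) * (k.choose m : ℝ) ∂P := by
    filter_upwards [eventually_ge_atTop 1] with n hn
    rw [integral_finsetSum _ (hint n hn)]
  refine Tendsto.congr' this (tendsto_finsetSum _ fun m _ => ?_)
  simp_rw [integral_mul_const]
  exact ((h.pow_moments m).2.2.mul (hc.neg.pow _)).mul_const _

theorem momentsConverge (h : TailConverge U P V Q) : MomentsConverge U P V Q := by
  simpa using h.momentsConverge_sub (c := fun _ => 0) (fun _ => le_rfl) tendsto_const_nhds

theorem momentsConverge_centered (h : TailConverge U P V Q) :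
    MomentsConverge (fun n ω => U n ω - ∫ ω', U n ω' ∂P) P (fun ω => V ω - ∫ ω', V ω' ∂Q) Q := by
  refine h.momentsConverge_sub (fun n => integral_nonneg_of_ae (h.nonneg n)) ?_
  simpa using (h.pow_moments 1).2.2

end TailConverge

theorem MomentsConverge.neg {W : ℕ → Ω → ℝ} {P : Measure Ω} {V : Ω' → ℝ} {Q : Measure Ω'}
    (h : MomentsConverge W P V Q) :
    MomentsConverge (fun n ω => -W n ω) P (fun ω => -V ω) Q := by
  refine ⟨fun k => ?_, fun r hr => by simpa only [abs_neg] using h.2 r hr⟩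
  obtain ⟨h1, h2, h3⟩ := h.1 k
  obtain ⟨s, e⟩ : ∃ s : ℝ, ∀ x : ℝ, (-x) ^ k = s * x ^ k := ⟨(-1) ^ k, fun x => neg_pow x k⟩
  simp_rw [e, integral_const_mul]
  exact ⟨fun n hn => (h1 n hn).const_mul _, h2.const_mul _, h3.const_mul _⟩

end CoinToss

/-! ### Pathwise description of the two hitting times -/

namespace CoinToss

variable {Ω Ω' : Type*}

/-- The sum of the first `N` tosses. -/
def tossSum (ξ : ℕ → Ω → ℤ) (N : ℕ) (ω : Ω) : ℤ := ∑ i ∈ Finset.Icc 1 N, ξ i ω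

section Pathwise

variable {ξ : ℕ → Ω → ℤ} {ω : Ω}

theorem numHeads_succ (ξ : ℕ → Ω → ℤ) (N : ℕ) (ω : Ω) :
    numHeads ξ (N + 1) ω = numHeads ξ N ω + if ξ (N + 1) ω = 1 then 1 else 0 := by
  simp only [numHeads, Finset.card_filter]
  rw [Finset.sum_Icc_succ_top (by omega)]

theorem numTails_succ (ξ : ℕ → Ω → ℤ) (N : ℕ) (ω : Ω) :
    numTails ξ (N + 1) ω = numTails ξ N ω + if ξ (N + 1) ω = -1 then 1 else 0 := by
  simp only [numTails, Finset.card_filter]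
  rw [Finset.sum_Icc_succ_top (by omega)]

theorem numHeads_mono : Monotone fun N => numHeads ξ N ω :=
  monotone_nat_of_le_succ fun N => by simp [numHeads_succ]

theorem numTails_mono : Monotone fun N => numTails ξ N ω :=
  monotone_nat_of_le_succ fun N => by simp [numTails_succ]

/-- The count starts at `0` and rises by at most one per toss, so it skips no value. -/
theorem exists_numHeads_eq {n N : ℕ} (h : n ≤ numHeads ξ N ω) :
    ∃ M ≤ N, numHeads ξ M ω = n := by
  induction N with
  | zero => exact ⟨0, le_rfl, by simp_all [numHeads]⟩
  | succ N ih =>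
    by_cases hN : n ≤ numHeads ξ N ω
    · obtain ⟨M, hM, h'⟩ := ih hN
      exact ⟨M, by omega, h'⟩
    · refine ⟨N + 1, le_rfl, ?_⟩
      rw [numHeads_succ] at h ⊢
      split_ifs at h ⊢ <;> omega

theorem exists_numTails_eq {n N : ℕ} (h : n ≤ numTails ξ N ω) :
    ∃ M ≤ N, numTails ξ M ω = n := by
  induction N with
  | zero => exact ⟨0, le_rfl, by simp_all [numTails]⟩
  | succ N ih =>
    by_cases hN : n ≤ numTails ξ N ω
    · obtain ⟨M, hM, h'⟩ := ih hN
      exact ⟨M, by omega, h'⟩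
    · refine ⟨N + 1, le_rfl, ?_⟩
      rw [numTails_succ] at h ⊢
      split_ifs at h ⊢ <;> omega

theorem numHeads_add_numTails (hω : ∀ i, ξ i ω = 1 ∨ ξ i ω = -1) (N : ℕ) :
    numHeads ξ N ω + numTails ξ N ω = N := by
  induction N with
  | zero => simp [numHeads, numTails]
  | succ N ih =>
    rw [numHeads_succ, numTails_succ]
    rcases hω (N + 1) with h | h <;> simp [h] <;> omega

theorem numHeads_sub_numTails (hω : ∀ i, ξ i ω = 1 ∨ ξ i ω = -1) (N : ℕ) :
    (numHeads ξ N ω : ℤ) - numTails ξ N ω = tossSum ξ N ω := by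
  induction N with
  | zero => simp [numHeads, numTails, tossSum]
  | succ N ih =>
    rw [numHeads_succ, numTails_succ, tossSum, Finset.sum_Icc_succ_top (by omega), ← tossSum, ← ih]
    rcases hω (N + 1) with h | h <;> simp [h] <;> omega

theorem tossesOr_le_iff (hω : ∀ i, ξ i ω = 1 ∨ ξ i ω = -1) (n N : ℕ) :
    tossesOr ξ n ω ≤ N ↔ 2 * (n : ℤ) - N ≤ |tossSum ξ N ω| := by
  have hit {M : ℕ} (h : n ≤ numHeads ξ M ω ∨ n ≤ numTails ξ M ω) :
      ∃ M' ≤ M, M' ∈ {N : ℕ | numHeads ξ N ω = n ∨ numTails ξ N ω = n} := by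
    rcases h with h | h
    · obtain ⟨M', h1, h2⟩ := exists_numHeads_eq h
      exact ⟨M', h1, Or.inl h2⟩
    · obtain ⟨M', h1, h2⟩ := exists_numTails_eq h
      exact ⟨M', h1, Or.inr h2⟩
  have key : (n ≤ numHeads ξ N ω ∨ n ≤ numTails ξ N ω) ↔ 2 * (n : ℤ) - N ≤ |tossSum ξ N ω| := by
    have h1 := numHeads_add_numTails hω N
    have h2 := numHeads_sub_numTails hω N
    rw [le_abs]
    omega
  rw [← key]
  constructor
  · intro h
    -- Among `2n` tosses one side occurs at least `n` times; this excludes the default `sInf ∅ = 0`.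
    have hne : {N : ℕ | numHeads ξ N ω = n ∨ numTails ξ N ω = n}.Nonempty := by
      have h1 := numHeads_add_numTails hω (2 * n)
      obtain ⟨M', -, h'⟩ := hit (M := 2 * n) (by omega)
      exact ⟨M', h'⟩
    rcases Nat.sInf_mem hne with h' | h'
    · left
      rw [← h']
      exact numHeads_mono h
    · right
      rw [← h']
      exact numTails_mono h
  · intro h
    obtain ⟨M', h1, h2⟩ := hit h
    exact (Nat.sInf_le h2).trans h1

theorem tossesOr_le_two_mul (hω : ∀ i, ξ i ω = 1 ∨ ξ i ω = -1) (n : ℕ) :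
    tossesOr ξ n ω ≤ 2 * n := by
  rw [tossesOr_le_iff hω]
  push_cast
  simp

theorem le_numHeads_and_le_numTails_iff (hω : ∀ i, ξ i ω = 1 ∨ ξ i ω = -1) (n N : ℕ) :
    (n ≤ numHeads ξ N ω ∧ n ≤ numTails ξ N ω) ↔ |tossSum ξ N ω| ≤ (N : ℤ) - 2 * n := by
  have h1 := numHeads_add_numTails hω N
  have h2 := numHeads_sub_numTails hω N
  rw [abs_le]
  omega

theorem lt_tossesAnd_iff (hω : ∀ i, ξ i ω = 1 ∨ ξ i ω = -1) {n : ℕ}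
    (hne : ∃ M, n ≤ numHeads ξ M ω ∧ n ≤ numTails ξ M ω) (N : ℕ) :
    N < tossesAnd ξ n ω ↔ (N : ℤ) + 1 - 2 * n ≤ |tossSum ξ N ω| := by
  have key : tossesAnd ξ n ω ≤ N ↔ n ≤ numHeads ξ N ω ∧ n ≤ numTails ξ N ω := by
    refine ⟨fun h => ?_, fun h => Nat.sInf_le h⟩
    obtain ⟨h1, h2⟩ := Nat.sInf_mem (s := {N | n ≤ numHeads ξ N ω ∧ n ≤ numTails ξ N ω}) hne
    exact ⟨h1.trans (numHeads_mono h), h2.trans (numTails_mono h)⟩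
  rw [← not_le, key, le_numHeads_and_le_numTails_iff hω]
  omega

theorem two_mul_le_tossesAnd (hω : ∀ i, ξ i ω = 1 ∨ ξ i ω = -1) {n : ℕ}
    (hne : ∃ M, n ≤ numHeads ξ M ω ∧ n ≤ numTails ξ M ω) : 2 * n ≤ tossesAnd ξ n ω := by
  obtain ⟨h1, h2⟩ := Nat.sInf_mem (s := {N | n ≤ numHeads ξ N ω ∧ n ≤ numTails ξ N ω}) hne
  have h3 := numHeads_add_numTails hω (tossesAnd ξ n ω)
  simp only [tossesAnd] at h3 ⊢
  omega

end Pathwise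

theorem measurable_sInf_nat [MeasurableSpace Ω] {p : ℕ → Ω → Prop}
    (hp : ∀ N, MeasurableSet {ω | p N ω}) : Measurable fun ω => sInf {N | p N ω} := by
  refine measurable_of_Iic fun N => ?_
  have : (fun ω => sInf {N | p N ω}) ⁻¹' Set.Iic N =
      -- The last intersection accounts for `sInf ∅ = 0`.
      (⋃ M ∈ Finset.range (N + 1), {ω | p M ω}) ∪ ⋂ M, {ω | p M ω}ᶜ := by
    ext ω
    simp only [Set.mem_preimage, Set.mem_Iic, Finset.mem_range, Set.mem_union, Set.mem_iUnion,
      Set.mem_ofPred_eq, exists_prop, Set.mem_iInter, Set.mem_compl_iff]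
    constructor
    · intro h
      by_cases hne : ∃ M, p M ω
      · exact Or.inl ⟨_, Nat.lt_succ_of_le h, Nat.sInf_mem (s := {N | p N ω}) hne⟩
      · exact Or.inr (not_exists.1 hne)
    · rintro (⟨M, hM, h⟩ | h)
      · exact (Nat.sInf_le h).trans (Nat.lt_succ_iff.1 hM)
      · have : {N | p N ω} = ∅ := Set.eq_empty_iff_forall_notMem.2 h
        simp [this]
  rw [this]
  exact (Finset.measurableSet_biUnion _ fun M _ => hp M).union
    (MeasurableSet.iInter fun M => (hp M).compl)

/-! ### Hoeffding bound and central limit theorem for the walk -/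

namespace IsFairCoin

variable [MeasurableSpace Ω] [MeasurableSpace Ω'] {ξ : ℕ → Ω → ℤ} {P : Measure Ω}

theorem measurable_numHeads (hξ : IsFairCoin ξ P) (N : ℕ) : Measurable (numHeads ξ N) := by
  unfold numHeads
  simp only [Finset.card_filter]
  exact Finset.measurable_sum _ fun i _ => Measurable.ite
    (hξ.measurable i (measurableSet_singleton 1)) measurable_const measurable_const

theorem measurable_numTails (hξ : IsFairCoin ξ P) (N : ℕ) : Measurable (numTails ξ N) := by
  unfold numTails
  simp only [Finset.card_filter]
  exact Finset.measurable_sum _ fun i _ => Measurable.ite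
    (hξ.measurable i (measurableSet_singleton (-1))) measurable_const measurable_const

theorem measurable_tossesOr (hξ : IsFairCoin ξ P) (n : ℕ) : Measurable (tossesOr ξ n) :=
  measurable_sInf_nat fun N => (hξ.measurable_numHeads N (measurableSet_singleton n)).union
    (hξ.measurable_numTails N (measurableSet_singleton n))

theorem measurable_tossesAnd (hξ : IsFairCoin ξ P) (n : ℕ) : Measurable (tossesAnd ξ n) :=
  measurable_sInf_nat fun N => (hξ.measurable_numHeads N measurableSet_Ici).inter
    (hξ.measurable_numTails N measurableSet_Ici)

theorem iIndepFun_real (hξ : IsFairCoin ξ P) : iIndepFun (fun i ω => (ξ i ω : ℝ)) P :=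
  hξ.indep.comp (fun _ (z : ℤ) => (z : ℝ)) fun _ => by fun_prop

variable [IsProbabilityMeasure P]

theorem ae_heads_or_tails (hξ : IsFairCoin ξ P) : ∀ᵐ ω ∂P, ∀ i, ξ i ω = 1 ∨ ξ i ω = -1 := by
  refine ae_all_iff.2 fun i => ?_
  have h1 : MeasurableSet {ω | ξ i ω = 1} := hξ.measurable i (measurableSet_singleton 1)
  have h2 : MeasurableSet {ω | ξ i ω = -1} := hξ.measurable i (measurableSet_singleton (-1))
  refine (mem_ae_iff_prob_eq_one (h1.union h2)).2 ?_
  rw [measure_union _ h2, hξ.heads, hξ.tails, ENNReal.add_halves]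
  refine Set.disjoint_left.2 fun ω (h : ξ i ω = 1) (h' : ξ i ω = -1) => ?_
  omega

theorem map_toss_eq (hξ : IsFairCoin ξ P) (i j : ℕ) : P.map (ξ i) = P.map (ξ j) := by
  refine Measure.ext_of_singleton fun z => ?_
  rw [Measure.map_apply (hξ.measurable i) (measurableSet_singleton z),
    Measure.map_apply (hξ.measurable j) (measurableSet_singleton z)]
  have h0 (k : ℕ) (h1 : z ≠ 1) (h2 : z ≠ -1) : P (ξ k ⁻¹' {z}) = 0 := by
    refine measure_mono_null ?_ hξ.ae_heads_or_tails
    intro ω (h : ξ k ω = z) h'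
    rcases h' k with h' | h' <;> omega
  by_cases h1 : z = 1
  · subst h1
    exact (hξ.heads i).trans (hξ.heads j).symm
  by_cases h2 : z = -1
  · subst h2
    exact (hξ.tails i).trans (hξ.tails j).symm
  rw [h0 i h1 h2, h0 j h1 h2]

theorem identDistrib (hξ : IsFairCoin ξ P) (i j : ℕ) :
    IdentDistrib (fun ω => (ξ i ω : ℝ)) (fun ω => (ξ j ω : ℝ)) P P :=
  IdentDistrib.comp (u := fun z : ℤ => (z : ℝ))
    ⟨(hξ.measurable i).aemeasurable, (hξ.measurable j).aemeasurable, hξ.map_toss_eq i j⟩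
    (by fun_prop)

theorem integral_toss (hξ : IsFairCoin ξ P) (i : ℕ) : ∫ ω, (ξ i ω : ℝ) ∂P = 0 := by
  have h1 : MeasurableSet {ω | ξ i ω = 1} := hξ.measurable i (measurableSet_singleton 1)
  have : (fun ω => (ξ i ω : ℝ)) =ᵐ[P]
      fun ω => {ω | ξ i ω = 1}.indicator (fun _ => (2 : ℝ)) ω - 1 := by
    filter_upwards [hξ.ae_heads_or_tails] with ω hω
    rcases hω i with h | h
    · simp [Set.indicator, h]
      norm_num
    · simp [Set.indicator, h]
  rw [integral_congr_ae this, integral_sub ((integrable_const _).indicator h1) (integrable_const _),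
    integral_indicator_const _ h1, measureReal_def, hξ.heads]
  simp

theorem integral_toss_sq (hξ : IsFairCoin ξ P) (i : ℕ) : ∫ ω, (ξ i ω : ℝ) ^ 2 ∂P = 1 := by
  have : (fun ω => (ξ i ω : ℝ) ^ 2) =ᵐ[P] fun ω => 1 := by
    filter_upwards [hξ.ae_heads_or_tails] with ω hω
    rcases hω i with h | h <;> simp [h]
  rw [integral_congr_ae this]
  simp

/-- Hoeffding's lemma on `[-1, 1]`: the parameter is `((1 - (-1)) / 2) ^ 2 = 1`. -/
theorem hasSubgaussianMGF (hξ : IsFairCoin ξ P) (i : ℕ) :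
    HasSubgaussianMGF (fun ω => (ξ i ω : ℝ)) 1 P := by
  have h := hasSubgaussianMGF_of_mem_Icc_of_integral_eq_zero (a := -1) (b := 1) (μ := P)
    (X := fun ω => (ξ i ω : ℝ)) (hξ.identDistrib i i).aemeasurable_fst ?_ (hξ.integral_toss i)
  · convert h using 1
    ext
    norm_num
  · filter_upwards [hξ.ae_heads_or_tails] with ω hω
    rcases hω i with h | h <;> simp [h]

/-- Hoeffding's inequality for the simple random walk. -/
theorem measureReal_le_abs_tossSum (hξ : IsFairCoin ξ P) {N : ℕ} {M t : ℝ} (hNM : N ≤ M)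
    (ht : 0 < t) : P.real {ω | t ≤ |(tossSum ξ N ω : ℝ)|} ≤ 2 * Real.exp (-t ^ 2 / (2 * M)) := by
  rcases Nat.eq_zero_or_pos N with rfl | hN
  · have : {ω | t ≤ |(tossSum ξ 0 ω : ℝ)|} = ∅ := by
      ext ω
      simp [tossSum, ht]
    rw [this]
    simp only [measureReal_empty]
    positivity
  have hS := HasSubgaussianMGF.sum_of_iIndepFun hξ.iIndepFun_real (s := Finset.Icc 1 N)
    (c := fun _ => 1) fun i _ => hξ.hasSubgaussianMGF i
  have hmono : Real.exp (-t ^ 2 / (2 * N)) ≤ Real.exp (-t ^ 2 / (2 * M)) := by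
    have : (0 : ℝ) < N := by exact_mod_cast hN
    rw [Real.exp_le_exp, neg_div, neg_div, neg_le_neg_iff]
    gcongr
  have h1 := hS.measure_ge_le ht.le
  have h2 := hS.neg.measure_ge_le ht.le
  simp only [Finset.sum_const, Nat.card_Icc, add_tsub_cancel_right, nsmul_eq_mul, mul_one,
    NNReal.coe_natCast, Pi.neg_apply] at h1 h2
  calc P.real {ω | t ≤ |(tossSum ξ N ω : ℝ)|}
      ≤ P.real ({ω | t ≤ ∑ i ∈ Finset.Icc 1 N, (ξ i ω : ℝ)} ∪
        {ω | t ≤ -∑ i ∈ Finset.Icc 1 N, (ξ i ω : ℝ)}) := by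
        refine measureReal_mono fun ω (h : t ≤ |(tossSum ξ N ω : ℝ)|) => ?_
        simpa [tossSum, le_abs] using h
    _ ≤ _ := (measureReal_union_le _ _).trans (by linarith)

theorem tendstoInDistribution_tossSum (hξ : IsFairCoin ξ P) {Q : Measure Ω'}
    [IsProbabilityMeasure Q] {Z : Ω' → ℝ} (hZ : HasLaw Z (gaussianReal 0 1) Q) :
    TendstoInDistribution (fun (N : ℕ) ω => (√N)⁻¹ * (tossSum ξ N ω : ℝ)) atTop Z (fun _ => P) Q := by
  have h := tendstoInDistribution_inv_sqrt_mul_sum (P := P) (P' := Q)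
    (X := fun k ω => (ξ (k + 1) ω : ℝ)) hZ (hξ.integral_toss 1) (hξ.integral_toss_sq 1)
    (hξ.iIndepFun_real.precomp (add_left_injective 1)) fun i => hξ.identDistrib _ _
  convert h using 5 with N ω
  rw [tossSum]
  push_cast
  rw [Finset.range_eq_Ico, Finset.sum_Ico_add' (fun k => (ξ k ω : ℝ)) 0 N 1]
  rfl

theorem measure_abs_eq_zero_of_gaussian {Q : Measure Ω'} {Z : Ω' → ℝ}
    (hZ : HasLaw Z (gaussianReal 0 1) Q) (z : ℝ) : Q {ω | |Z ω| = z} = 0 := by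
  have : {ω | |Z ω| = z} = Z ⁻¹' {x | |x| = z} := rfl
  rw [this, ← Measure.map_apply_of_aemeasurable hZ.aemeasurable
    (measurableSet_eq_fun (by fun_prop) (by fun_prop)), hZ.map_eq]
  have := nullSingletonClass_gaussianReal (μ := 0) (v := 1) one_ne_zero
  refine Set.Finite.measure_zero (Set.Finite.subset (Set.toFinite {z, -z}) ?_) _
  intro x (hx : |x| = z)
  exact eq_or_eq_neg_of_abs_eq hx

/-- Slutsky's theorem moves the converging deterministic level into the variable `|·| - level`. The
portmanteau theorem then applies to `[0, ∞)`, whose frontier is null because `|Z|` has no atoms. -/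
theorem tendsto_measureReal_le_abs_tossSum (hξ : IsFairCoin ξ P) {Q : Measure Ω'}
    [IsProbabilityMeasure Q] {Z : Ω' → ℝ} (hZ : HasLaw Z (gaussianReal 0 1) Q)
    {N : ℕ → ℕ} (hN : Tendsto N atTop atTop) {a : ℕ → ℝ} {z : ℝ}
    (ha : Tendsto (fun n => (√(N n : ℝ))⁻¹ * a n) atTop (𝓝 z)) :
    Tendsto (fun n => P.real {ω | a n ≤ |(tossSum ξ (N n) ω : ℝ)|}) atTop
      (𝓝 (Q.real {ω | z ≤ |Z ω|})) := by
  have h0 := hξ.tendstoInDistribution_tossSum hZ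
  have h1 : TendstoInDistribution
      (fun n ω => (√(N n : ℝ))⁻¹ * (tossSum ξ (N n) ω : ℝ)) atTop Z (fun _ => P) Q :=
    ⟨fun n => h0.forall_aemeasurable (N n), h0.aemeasurable_limit, h0.tendsto.comp hN⟩
  have hY : TendstoInMeasure P (fun n _ => (√(N n : ℝ))⁻¹ * a n) atTop fun _ => z :=
    tendstoInMeasure_of_tendsto_ae (fun n => aestronglyMeasurable_const)
      (Eventually.of_forall fun _ => ha)
  have h2 := h1.continuous_comp_prodMk_of_tendstoInMeasure_const
    (g := fun p : ℝ × ℝ => |p.1| - p.2) (by fun_prop) hY fun _ => aemeasurable_const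
  have hZm := hZ.aemeasurable
  have hfr : Q.map (fun ω => |Z ω| - z) (frontier (Set.Ici 0)) = 0 := by
    rw [frontier_Ici, Measure.map_apply_of_aemeasurable (by fun_prop) (measurableSet_singleton 0)]
    convert measure_abs_eq_zero_of_gaussian hZ z using 2
    ext ω
    simp [sub_eq_zero]
  have h3 := ProbabilityMeasure.tendsto_measure_of_null_frontier_of_tendsto' h2.tendsto hfr
  have e1 : Q.map (fun ω => |Z ω| - z) (Set.Ici 0) = Q {ω | z ≤ |Z ω|} := by
    rw [Measure.map_apply_of_aemeasurable (by fun_prop) measurableSet_Ici]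
    congr 1
    ext ω
    simp
  simp only [ProbabilityMeasure.coe_mk, e1] at h3
  have h4 := (ENNReal.tendsto_toReal (measure_ne_top Q _)).comp h3
  refine h4.congr' ?_
  filter_upwards [hN.eventually_ge_atTop 1] with n hn
  have hpos : 0 < (√(N n : ℝ))⁻¹ := by
    have : (0 : ℝ) < N n := by exact_mod_cast hn
    positivity
  simp only [Function.comp_apply]
  rw [Measure.map_apply_of_aemeasurable (h2.forall_aemeasurable n) measurableSet_Ici,
    measureReal_def]
  congr 2
  ext ω
  simp only [Set.mem_preimage, Set.mem_Ici, Set.mem_ofPred_eq, abs_mul, abs_of_pos hpos, sub_nonneg]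
  exact mul_le_mul_iff_right₀ hpos

end IsFairCoin

end CoinToss

/-! ### Tails of the normalized hitting times -/

namespace CoinToss

theorem measureReal_congr_iff {Ω : Type*} [MeasurableSpace Ω] {P : Measure Ω} {p q : Ω → Prop}
    (h : ∀ᵐ ω ∂P, p ω ↔ q ω) : P.real {ω | p ω} = P.real {ω | q ω} :=
  measureReal_congr (h.mono fun _ => propext)

theorem tendsto_inv_sqrt_natCast : Tendsto (fun n : ℕ => (√(n : ℝ))⁻¹) atTop (𝓝 0) :=
  tendsto_inv_atTop_zero.comp (Real.tendsto_sqrt_atTop.comp tendsto_natCast_atTop_atTop)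

theorem tendsto_div_natCast_of_sub_div_sqrt {N : ℕ → ℕ} {y : ℝ}
    (h : Tendsto (fun n : ℕ => ((N n : ℝ) - 2 * n) / √(n : ℝ)) atTop (𝓝 y)) :
    Tendsto (fun n => (N n : ℝ) / n) atTop (𝓝 2) := by
  have h2 := (h.mul tendsto_inv_sqrt_natCast).const_add 2
  rw [mul_zero, add_zero] at h2
  refine h2.congr' ?_
  filter_upwards [eventually_ge_atTop 1] with n hn
  have hn' : (0 : ℝ) < n := by exact_mod_cast hn
  have : √(n : ℝ) * √(n : ℝ) = n := Real.mul_self_sqrt hn'.le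
  rw [← div_eq_mul_inv, div_div, this]
  field_simp
  ring

namespace IsFairCoin

variable {Ω Ω' : Type*} [MeasurableSpace Ω] [MeasurableSpace Ω'] {ξ : ℕ → Ω → ℤ} {P : Measure Ω}
  [IsProbabilityMeasure P]

/-- The factor `√2` arises from `√N ~ √2 √n`. -/
theorem tendsto_measureReal_le_abs_tossSum_two_mul (hξ : IsFairCoin ξ P) {Q : Measure Ω'}
    [IsProbabilityMeasure Q] {Z : Ω' → ℝ} (hZ : HasLaw Z (gaussianReal 0 1) Q)
    {N : ℕ → ℕ} (hN : Tendsto (fun n => (N n : ℝ) / n) atTop (𝓝 2)) {a : ℕ → ℝ} {y : ℝ}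
    (ha : Tendsto (fun n : ℕ => a n / √(n : ℝ)) atTop (𝓝 y)) :
    Tendsto (fun n => P.real {ω | a n ≤ |(tossSum ξ (N n) ω : ℝ)|}) atTop
      (𝓝 (Q.real {ω | y ≤ √2 * |Z ω|})) := by
  have hNtop : Tendsto N atTop atTop := by
    rw [← tendsto_natCast_atTop_iff (R := ℝ)]
    refine (hN.pos_mul_atTop two_pos tendsto_natCast_atTop_atTop).congr' ?_
    filter_upwards [eventually_ge_atTop 1] with n hn
    have : (n : ℝ) ≠ 0 := by positivity
    field_simp
  have hlim : Tendsto (fun n => (√(N n : ℝ))⁻¹ * a n) atTop (𝓝 ((√2)⁻¹ * y)) := by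
    refine ((hN.sqrt.inv₀ (by positivity)).mul ha).congr' ?_
    filter_upwards [eventually_ge_atTop 1] with n hn
    have : (0 : ℝ) < n := by exact_mod_cast hn
    have : √(n : ℝ) ≠ 0 := by positivity
    rw [Real.sqrt_div (by positivity), inv_div]
    field_simp
  have : {ω | y ≤ √2 * |Z ω|} = {ω | (√2)⁻¹ * y ≤ |Z ω|} := by
    ext ω
    exact (inv_mul_le_iff₀ (show 0 < √(2 : ℝ) by positivity)).symm
  rw [this]
  exact hξ.tendsto_measureReal_le_abs_tossSum hZ hNtop hlim

theorem measureReal_le_abs_tossSum_le_exp (hξ : IsFairCoin ξ P) {n N : ℕ} (hn : 1 ≤ n) {a t : ℝ}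
    (ht : 0 < t) (hN : N ≤ n * (2 + t)) (ha : t * √(n : ℝ) ≤ a) :
    P.real {ω | a ≤ |(tossSum ξ N ω : ℝ)|} ≤ (2 * Real.exp 1) * Real.exp (-(1 / 2) * t) := by
  have hn' : (0 : ℝ) < n := by exact_mod_cast hn
  calc P.real {ω | a ≤ |(tossSum ξ N ω : ℝ)|}
      ≤ P.real {ω | t * √(n : ℝ) ≤ |(tossSum ξ N ω : ℝ)|} :=
        measureReal_mono fun ω (h : a ≤ |(tossSum ξ N ω : ℝ)|) => ha.trans h
    _ ≤ 2 * Real.exp (-(t * √(n : ℝ)) ^ 2 / (2 * (n * (2 + t)))) :=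
        hξ.measureReal_le_abs_tossSum hN (by positivity)
    _ ≤ 2 * Real.exp (1 + -(1 / 2) * t) := by
        gcongr
        rw [mul_pow, Real.sq_sqrt hn'.le, div_le_iff₀ (by positivity)]
        -- After cancelling `n` this is `t² / (2(2 + t)) ≥ t/2 - 1`, that is, `t² ≥ t² - 4`.
        nlinarith
    _ = _ := by rw [Real.exp_add]; ring

theorem ae_le_tossesOr_iff (hξ : IsFairCoin ξ P) {n : ℕ} (hn : 1 ≤ n) {x : ℝ}
    (hx : x * √(n : ℝ) ≤ 2 * n) :
    ∀ᵐ ω ∂P, x ≤ (2 * n - (tossesOr ξ n ω : ℝ)) / √(n : ℝ) ↔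
      2 * (n : ℝ) - ⌊2 * n - x * √(n : ℝ)⌋₊ ≤
        |(tossSum ξ ⌊2 * n - x * √(n : ℝ)⌋₊ ω : ℝ)| := by
  filter_upwards [hξ.ae_heads_or_tails] with ω hω
  have hn' : (0 : ℝ) < n := by exact_mod_cast hn
  have h := tossesOr_le_iff hω n ⌊2 * n - x * √(n : ℝ)⌋₊
  rw [Nat.le_floor_iff (by linarith)] at h
  rw [le_div_iff₀ (by positivity), le_sub_comm, h, ← Int.cast_abs]
  exact_mod_cast Iff.rfl

theorem tailConverge_tossesOr (hξ : IsFairCoin ξ P) {Q : Measure Ω'}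
    [IsProbabilityMeasure Q] {Z : Ω' → ℝ} (hZ : HasLaw Z (gaussianReal 0 1) Q) :
    TailConverge (fun n ω => (2 * n - (tossesOr ξ n ω : ℝ)) / √(n : ℝ)) P
      (fun ω => √2 * |Z ω|) Q where
  aemeasurable n := by
    have := hξ.measurable_tossesOr n
    fun_prop
  aemeasurable_limit := by
    have := hZ.aemeasurable
    fun_prop
  nonneg n := by
    filter_upwards [hξ.ae_heads_or_tails] with ω hω
    have : (tossesOr ξ n ω : ℝ) ≤ 2 * n := by exact_mod_cast tossesOr_le_two_mul hω n
    exact div_nonneg (by linarith) (Real.sqrt_nonneg _)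
  nonneg_limit ω := by positivity
  noAtom y := by
    convert measure_abs_eq_zero_of_gaussian hZ (y / √2) using 2
    ext ω
    simp only [Set.mem_ofPred_eq]
    rw [eq_div_iff (by positivity), mul_comm]
  tail := by
    refine ⟨2 * Real.exp 1, 1 / 2, by norm_num, fun n hn t ht => ?_⟩
    have hn' : (0 : ℝ) < n := by exact_mod_cast hn
    by_cases htn : t * √(n : ℝ) ≤ 2 * n
    · have hN : (⌊2 * n - t * √(n : ℝ)⌋₊ : ℝ) ≤ 2 * n - t * √(n : ℝ) := Nat.floor_le (by linarith)
      have h0 : 0 < t * √(n : ℝ) := by positivity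
      rw [measureReal_congr_iff (hξ.ae_le_tossesOr_iff hn htn)]
      exact hξ.measureReal_le_abs_tossSum_le_exp hn ht (by nlinarith) (by linarith)
    -- Here the event would force `X_n < 0`.
    · have : {ω | t ≤ (2 * n - (tossesOr ξ n ω : ℝ)) / √(n : ℝ)} = ∅ := by
        refine Set.eq_empty_iff_forall_notMem.2
          fun ω (h : t ≤ (2 * n - (tossesOr ξ n ω : ℝ)) / √(n : ℝ)) => htn ?_
        rw [le_div_iff₀ (by positivity)] at h
        exact h.trans (by simp)
      rw [this, measureReal_empty]
      positivity
  tendsto y y₀ _ hy := by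
    have hle : ∀ᶠ n : ℕ in atTop, 1 ≤ n ∧ y n * √(n : ℝ) ≤ 2 * n := by
      have h := (hy.mul tendsto_inv_sqrt_natCast).eventually (gt_mem_nhds (show y₀ * 0 < 2 by norm_num))
      filter_upwards [h, eventually_ge_atTop 1] with n h hn
      have hn' : (0 : ℝ) < n := by exact_mod_cast hn
      have hs : 0 < √(n : ℝ) := by positivity
      refine ⟨hn, ?_⟩
      rw [← div_eq_mul_inv, div_lt_iff₀ hs] at h
      nlinarith [Real.mul_self_sqrt hn'.le]
    have ha : Tendsto (fun n : ℕ => (2 * (n : ℝ) - ⌊2 * n - y n * √(n : ℝ)⌋₊) / √(n : ℝ)) atTop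
        (𝓝 y₀) := by
      -- Rounding changes the level by less than `1`, hence by less than `1/√n` after scaling.
      have hup : Tendsto (fun n : ℕ => y n + (√(n : ℝ))⁻¹) atTop (𝓝 y₀) := by
        simpa using hy.add tendsto_inv_sqrt_natCast
      refine tendsto_of_tendsto_of_tendsto_of_le_of_le' hy hup ?_ ?_
      · filter_upwards [hle] with n hn
        have hn' : (0 : ℝ) < n := by exact_mod_cast hn.1
        rw [le_div_iff₀ (by positivity)]
        linarith [Nat.floor_le (sub_nonneg.2 hn.2)]
      · filter_upwards [hle] with n hn
        have hn' : (0 : ℝ) < n := by exact_mod_cast hn.1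
        rw [div_le_iff₀ (by positivity), add_mul, inv_mul_cancel₀ (by positivity)]
        linarith [Nat.lt_floor_add_one (2 * n - y n * √(n : ℝ))]
    have hN := tendsto_div_natCast_of_sub_div_sqrt (ha.neg.congr fun n => by rw [← neg_div, neg_sub])
    refine (hξ.tendsto_measureReal_le_abs_tossSum_two_mul hZ hN ha).congr' ?_
    filter_upwards [hle] with n hn
    exact (measureReal_congr_iff (hξ.ae_le_tossesOr_iff hn.1 hn.2)).symm

/-- If one side never reaches `n`, then `|S_N| > N - 2n ≥ N/2` for every `N ≥ 4n`. Hoeffding bounds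
this by `2 exp(-N/8)`, which tends to `0`. -/
theorem ae_exists_le_numHeads_and_le_numTails (hξ : IsFairCoin ξ P) (n : ℕ) :
    ∀ᵐ ω ∂P, ∃ M, n ≤ numHeads ξ M ω ∧ n ≤ numTails ξ M ω := by
  have hb (N : ℕ) (hN : 4 * n + 1 ≤ N) :
      P.real {ω | ¬ ∃ M, n ≤ numHeads ξ M ω ∧ n ≤ numTails ξ M ω} ≤
        2 * Real.exp (-((N : ℝ) / 8)) := by
    have hN' : 4 * (n : ℝ) + 1 ≤ N := by exact_mod_cast hN
    have hn0 : (0 : ℝ) ≤ n := n.cast_nonneg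
    calc P.real {ω | ¬ ∃ M, n ≤ numHeads ξ M ω ∧ n ≤ numTails ξ M ω}
        ≤ P.real {ω | (N : ℝ) / 2 ≤ |(tossSum ξ N ω : ℝ)|} := by
          refine ENNReal.toReal_mono (measure_ne_top _ _) (measure_mono_ae ?_)
          filter_upwards [hξ.ae_heads_or_tails] with ω hω hne
          have h := mt (le_numHeads_and_le_numTails_iff hω n N).2 (not_exists.1 hne N)
          have h' : (N : ℝ) - 2 * n < |(tossSum ξ N ω : ℝ)| := by
            rw [← Int.cast_abs]
            exact_mod_cast not_le.1 h
          change (N : ℝ) / 2 ≤ |(tossSum ξ N ω : ℝ)|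
          linarith
      _ ≤ 2 * Real.exp (-((N : ℝ) / 2) ^ 2 / (2 * N)) :=
          hξ.measureReal_le_abs_tossSum le_rfl (by linarith)
      _ = _ := by
          congr 2
          have : (N : ℝ) ≠ 0 := by linarith
          field_simp
          norm_num
  have hlim : Tendsto (fun N : ℕ => 2 * Real.exp (-((N : ℝ) / 8))) atTop (𝓝 0) := by
    have h : Tendsto (fun N : ℕ => (N : ℝ) / 8) atTop atTop :=
      tendsto_natCast_atTop_atTop.atTop_div_const (by norm_num)
    simpa using (Real.tendsto_exp_neg_atTop_nhds_zero.comp h).const_mul 2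
  have h0 := le_antisymm
    (ge_of_tendsto hlim (by filter_upwards [eventually_ge_atTop _] with N hN using hb N hN))
    measureReal_nonneg
  rw [ae_iff]
  exact (measureReal_eq_zero_iff).1 h0

/-- For an integer, `Y_n ≥ u` means `Y_n > ⌈u⌉ - 1`, so the walk is read one step before the
ceiling. With `n ≥ 1` and `x ≥ 0` the ceiling is positive and the natural subtraction is exact. -/
theorem ae_le_tossesAnd_iff (hξ : IsFairCoin ξ P) {n : ℕ} (hn : 1 ≤ n) {x : ℝ} (hx : 0 ≤ x) :
    ∀ᵐ ω ∂P, x ≤ ((tossesAnd ξ n ω : ℝ) - 2 * n) / √(n : ℝ) ↔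
      (⌈2 * n + x * √(n : ℝ)⌉₊ : ℝ) - 2 * n ≤
        |(tossSum ξ (⌈2 * n + x * √(n : ℝ)⌉₊ - 1) ω : ℝ)| := by
  filter_upwards [hξ.ae_heads_or_tails, hξ.ae_exists_le_numHeads_and_le_numTails n] with ω hω hne
  have hn' : (0 : ℝ) < n := by exact_mod_cast hn
  have h := lt_tossesAnd_iff hω hne (⌈2 * n + x * √(n : ℝ)⌉₊ - 1)
  have hc : 1 ≤ ⌈2 * n + x * √(n : ℝ)⌉₊ := Nat.one_le_ceil_iff.2 (by positivity)
  rw [← Nat.add_one_le_iff, Nat.sub_add_cancel hc, Nat.ceil_le, Nat.cast_sub hc, Nat.cast_one,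
    sub_add_cancel] at h
  rw [le_div_iff₀ (by positivity), le_sub_iff_add_le', h, ← Int.cast_abs]
  exact_mod_cast Iff.rfl

theorem tailConverge_tossesAnd (hξ : IsFairCoin ξ P) {Q : Measure Ω'}
    [IsProbabilityMeasure Q] {Z : Ω' → ℝ} (hZ : HasLaw Z (gaussianReal 0 1) Q) :
    TailConverge (fun n ω => ((tossesAnd ξ n ω : ℝ) - 2 * n) / √(n : ℝ)) P
      (fun ω => √2 * |Z ω|) Q where
  aemeasurable n := by
    have := hξ.measurable_tossesAnd n
    fun_prop
  aemeasurable_limit := (hξ.tailConverge_tossesOr hZ).aemeasurable_limit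
  nonneg n := by
    filter_upwards [hξ.ae_heads_or_tails, hξ.ae_exists_le_numHeads_and_le_numTails n] with ω hω hne
    have : 2 * (n : ℝ) ≤ tossesAnd ξ n ω := by exact_mod_cast two_mul_le_tossesAnd hω hne
    exact div_nonneg (by linarith) (Real.sqrt_nonneg _)
  nonneg_limit := (hξ.tailConverge_tossesOr hZ).nonneg_limit
  noAtom := (hξ.tailConverge_tossesOr hZ).noAtom
  tail := by
    refine ⟨2 * Real.exp 1, 1 / 2, by norm_num, fun n hn t ht => ?_⟩
    have hn' : (1 : ℝ) ≤ n := by exact_mod_cast hn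
    have hc : 1 ≤ ⌈2 * n + t * √(n : ℝ)⌉₊ := Nat.one_le_ceil_iff.2 (by positivity)
    rw [measureReal_congr_iff (hξ.ae_le_tossesAnd_iff hn ht.le)]
    refine hξ.measureReal_le_abs_tossSum_le_exp hn ht ?_ ?_
    · rw [Nat.cast_sub hc, Nat.cast_one]
      -- The time `⌈2n + t√n⌉ - 1` is below `2n + t√n ≤ n(2 + t)`, using `√n ≤ n`.
      have h1 := Nat.ceil_lt_add_one (a := 2 * n + t * √(n : ℝ)) (by positivity)
      have h2 : √(n : ℝ) ≤ n := Real.sqrt_le_self_iff.2 (Or.inr hn')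
      nlinarith
    · linarith [Nat.le_ceil (2 * n + t * √(n : ℝ))]
  tendsto y y₀ hy₀ hy := by
    have hle : ∀ᶠ n : ℕ in atTop, 1 ≤ n ∧ 0 ≤ y n := by
      filter_upwards [hy.eventually (lt_mem_nhds hy₀), eventually_ge_atTop 1] with n h hn
      exact ⟨hn, h.le⟩
    have ha : Tendsto (fun n : ℕ => ((⌈2 * n + y n * √(n : ℝ)⌉₊ : ℝ) - 2 * n) / √(n : ℝ)) atTop
        (𝓝 y₀) := by
      have hup : Tendsto (fun n : ℕ => y n + (√(n : ℝ))⁻¹) atTop (𝓝 y₀) := by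
        simpa using hy.add tendsto_inv_sqrt_natCast
      refine tendsto_of_tendsto_of_tendsto_of_le_of_le' hy hup ?_ ?_
      · filter_upwards [hle] with n hn
        have hn' : (0 : ℝ) < n := by exact_mod_cast hn.1
        rw [le_div_iff₀ (by positivity)]
        linarith [Nat.le_ceil (2 * n + y n * √(n : ℝ))]
      · filter_upwards [hle] with n hn
        have hn' : (0 : ℝ) < n := by exact_mod_cast hn.1
        have hy' := hn.2
        rw [div_le_iff₀ (by positivity), add_mul, inv_mul_cancel₀ (by positivity)]
        linarith [Nat.ceil_lt_add_one (a := 2 * n + y n * √(n : ℝ)) (by positivity)]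
    have hN : Tendsto (fun n : ℕ => ((⌈2 * n + y n * √(n : ℝ)⌉₊ - 1 : ℕ) : ℝ) / n) atTop (𝓝 2) := by
      refine tendsto_div_natCast_of_sub_div_sqrt (y := y₀) ?_
      have h := ha.sub tendsto_inv_sqrt_natCast
      rw [sub_zero] at h
      refine h.congr' ?_
      filter_upwards [hle] with n hn
      have hn' : (0 : ℝ) < n := by exact_mod_cast hn.1
      have hy' := hn.2
      rw [Nat.cast_sub (Nat.one_le_ceil_iff.2 (by positivity)), Nat.cast_one]
      ring
    refine (hξ.tendsto_measureReal_le_abs_tossSum_two_mul hZ hN ha).congr' ?_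
    filter_upwards [hle] with n hn
    exact (measureReal_congr_iff (hξ.ae_le_tossesAnd_iff hn.1 hn.2)).symm

end IsFairCoin

/-- Centering commutes with the affine normalization. -/
theorem sub_integral_div_sqrt {Ω : Type*} [MeasurableSpace Ω] {P : Measure Ω}
    [IsProbabilityMeasure P] {T : ℕ → Ω → ℝ}
    (hT : ∀ n : ℕ, 1 ≤ n → Integrable (fun ω => (T n ω - 2 * n) / √(n : ℝ)) P) (n : ℕ) (ω : Ω) :
    (T n ω - 2 * n) / √(n : ℝ) - ∫ ω', (T n ω' - 2 * n) / √(n : ℝ) ∂P =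
      (T n ω - ∫ ω', T n ω' ∂P) / √(n : ℝ) := by
  -- At `n = 0` every quotient is a division by `√0`, hence `0`.
  rcases Nat.eq_zero_or_pos n with rfl | hn
  · simp
  have hn' : (0 : ℝ) < n := by exact_mod_cast hn
  have hs : √(n : ℝ) ≠ 0 := by positivity
  have hi : Integrable (T n) P := by
    refine (((hT n hn).mul_const √(n : ℝ)).add (integrable_const (2 * (n : ℝ)))).congr
      (Eventually.of_forall fun ω => ?_)
    simp only [Pi.add_apply]
    field_simp
    ring
  rw [integral_div, integral_sub hi (integrable_const _)]
  simp only [integral_const, probReal_univ, one_smul]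
  ring

end CoinToss

theorem mainTheorem5
    {Ω Ω' : Type*} [MeasurableSpace Ω] [MeasurableSpace Ω']
    (P : Measure Ω) [IsProbabilityMeasure P] (Q : Measure Ω') [IsProbabilityMeasure Q]
    (ξ : ℕ → Ω → ℤ) (hξ : CoinToss.IsFairCoin ξ P)
    (Z : Ω' → ℝ) (hZ : HasLaw Z (gaussianReal 0 1) Q) :
    CoinToss.MomentsConverge
      (fun n ω => ((CoinToss.tossesOr ξ n ω : ℝ) - 2 * n) / √(n : ℝ)) P
      (fun ω => -(√2 * |Z ω|)) Q ∧
    CoinToss.MomentsConverge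
      (fun n ω => ((CoinToss.tossesOr ξ n ω : ℝ)
        - ∫ ω', (CoinToss.tossesOr ξ n ω' : ℝ) ∂P) / √(n : ℝ)) P
      (fun ω => -(√2 * (|Z ω| - ∫ ω', |Z ω'| ∂Q))) Q ∧
    CoinToss.MomentsConverge
      (fun n ω => ((CoinToss.tossesAnd ξ n ω : ℝ) - 2 * n) / √(n : ℝ)) P
      (fun ω => √2 * |Z ω|) Q ∧
    CoinToss.MomentsConverge
      (fun n ω => ((CoinToss.tossesAnd ξ n ω : ℝ)
        - ∫ ω', (CoinToss.tossesAnd ξ n ω' : ℝ) ∂P) / √(n : ℝ)) P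
      (fun ω => √2 * (|Z ω| - ∫ ω', |Z ω'| ∂Q)) Q := by
  have hX := hξ.tailConverge_tossesOr hZ
  have hY := hξ.tailConverge_tossesAnd hZ
  have eX (n : ℕ) (ω : Ω) : -((2 * n - (CoinToss.tossesOr ξ n ω : ℝ)) / √(n : ℝ)) =
      ((CoinToss.tossesOr ξ n ω : ℝ) - 2 * n) / √(n : ℝ) := by
    rw [← neg_div, neg_sub]
  -- `TailConverge` needs nonnegative variables, so it was proved for `2n - X_n` and the sign is
  -- restored here.
  have hX1 := hX.momentsConverge.neg
  simp only [eX] at hX1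
  have hX2 := hX.momentsConverge_centered.neg
  have hY1 := hY.momentsConverge
  have hY2 := hY.momentsConverge_centered
  have eXc (n : ℕ) (ω : Ω) : -((2 * n - (CoinToss.tossesOr ξ n ω : ℝ)) / √(n : ℝ) -
      ∫ ω', (2 * n - (CoinToss.tossesOr ξ n ω' : ℝ)) / √(n : ℝ) ∂P) =
      ((CoinToss.tossesOr ξ n ω : ℝ) - ∫ ω', (CoinToss.tossesOr ξ n ω' : ℝ) ∂P) / √(n : ℝ) := by
    rw [neg_sub', ← integral_neg]
    simp_rw [eX]
    exact CoinToss.sub_integral_div_sqrt (T := fun n ω => (CoinToss.tossesOr ξ n ω : ℝ))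
      (fun n hn => by simpa only [pow_one] using (hX1.1 1).1 n hn) n ω
  have eYc := CoinToss.sub_integral_div_sqrt (P := P)
    (T := fun n ω => (CoinToss.tossesAnd ξ n ω : ℝ))
    (fun n hn => by simpa only [pow_one] using (hY1.1 1).1 n hn)
  have eV (ω : Ω') : √2 * |Z ω| - ∫ ω', √2 * |Z ω'| ∂Q = √2 * (|Z ω| - ∫ ω', |Z ω'| ∂Q) := by
    rw [integral_const_mul, mul_sub]
  simp only [eXc, eV] at hX2
  simp only [eYc, eV] at hY2
  exact ⟨hX1, hX2, hY1, hY2⟩
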